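/- **Theorem 3.2.** Let $\mathcal T=\{T_t\}_{t\in\mathbb R}$ and $\mathcal S=\{S_t\}_{t\in\mathbb R}$ be measure preserving flows (jointly measurable actions of $\mathbb R$ by measure preserving maps) on standard Borel probability spaces $(X,\mathcal B,\mu)$ and $(Y,\mathcal C,\nu)$. Assume that both flows are weakly mixing, i.e. if $f$ is a complex $L^2$-function and $a\in\mathbb R$ are such that for every $t\in\mathbb R$ the flow at time $t$ maps $f$ to $e^{iat}f$ (for $\mathcal T$: $f\circ T_t=e^{iat}f$ almost everywhere), then $f$ is almost everywhere constant. Let $P,Q$ be Borel probability measures on $\mathbb R$ with exponential decay, where $P$ has exponential decay if there are $c,b>0$ with $P\big((-\infty,-t)\cup(t,\infty)\big)<ce^{-bt}$ for every $t>0$. Let $P(\mathcal T)$ be the operator on $L^2(X,\mu)$ determined by $$\langle P(\mathcal T)f,g\rangle=\int_{\mathbb R}\langle f\circ T_{-t},g\rangle\,dP(t)\qquad (f,g\in L^2(X,\mu)),$$ and define $Q(\mathcal S)$ on $L^2(Y,\nu)$ in the same way. Suppose that there is a real sequence $t_n\to\infty$ such that $$T_{t_n}\to P(\mathcal T)\quad\text{and}\quad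 S_{t_n}\to Q(\mathcal S)\quad\text{weakly},$$ i.e. $\langle f\circ T_{t_n},g\rangle\to\langle P(\mathcal T)f,g\rangle$ for all $f,g\in L^2(X,\mu)$, and likewise for $\mathcal S$. If $P\neq Q$, then $\mathcal T$ and $\mathcal S$ are spectrally disjoint, i.e. their maximal spectral types $\sigma_{\mathcal T}$ and $\sigma_{\mathcal S}$ are mutually singular. Here, for $f\in L^2(X,\mu)$, the spectral measure $\sigma_f$ is the finite Borel measure on $\mathbb R$ with $\int e^{its}\,d\sigma_f(s)=\langle f\circ T_{-t},f\rangle$ for all $t\in\mathbb R$, and a maximal spectral type $\sigma_{\mathcal T}$ is a spectral measure of some $h\in L^2(X,\mu)$ with $\int h\,d\mu=0$ such that $\sigma_f\ll\sigma_{\mathcal T}$ for every $f\in L^2(X,\mu)$ with $\int f\,d\mu=0$; it exists and is unique up to mutual absolute continuity. -/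

import Mathlib

open MeasureTheory Filter Topology

/-- A measure preserving flow on `(X, μ)`: a jointly measurable action of the additive group `ℝ`
by transformations preserving `μ`. -/
structure MeasureFlow (X : Type*) [MeasurableSpace X] (μ : Measure X) where
  /-- the time-`t` map `T_t` -/
  toFun : ℝ → X → X
  measurable_uncurry : Measurable (fun p : ℝ × X => toFun p.1 p.2)
  map_zero : ∀ x, toFun 0 x = x
  map_add : ∀ s t x, toFun (s + t) x = toFun s (toFun t x)
  measurePreserving : ∀ t, MeasurePreserving (toFun t) μ μ

namespace MeasureFlow

variable {X : Type*} [MeasurableSpace X] {μ : Measure X}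

/-- The Koopman operator `f ↦ f ∘ T_t` on the complex Hilbert space `L²(X, μ)`. -/
noncomputable def koopman (T : MeasureFlow X μ) (t : ℝ) : Lp ℂ 2 μ →ₗᵢ[ℂ] Lp ℂ 2 μ :=
  Lp.compMeasurePreservingₗᵢ ℂ (T.toFun t) (T.measurePreserving t)

theorem coeFn_koopman (T : MeasureFlow X μ) (t : ℝ) (f : Lp ℂ 2 μ) :
    T.koopman t f =ᵐ[μ] fun x => f (T.toFun t x) :=
  Lp.coeFn_compMeasurePreserving f (T.measurePreserving t)

theorem measurable_inner_koopman [SFinite μ] (T : MeasureFlow X μ) (f g : Lp ℂ 2 μ) :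
    Measurable fun t : ℝ => inner ℂ (T.koopman (-t) f) g := by
  have h : ∀ t : ℝ, inner ℂ (T.koopman (-t) f) g
      = ∫ x, inner ℂ (f (T.toFun (-t) x)) (g x) ∂μ := by
    intro t
    rw [L2.inner_def]
    refine integral_congr_ae ?_
    filter_upwards [T.coeFn_koopman (-t) f] with x hx
    rw [hx]
  simp_rw [h]
  have hm : Measurable fun p : ℝ × X => T.toFun (-p.1) p.2 :=
    T.measurable_uncurry.comp (measurable_fst.neg.prodMk measurable_snd)
  have h1 : StronglyMeasurable fun p : ℝ × X => f (T.toFun (-p.1) p.2) :=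
    (Lp.stronglyMeasurable f).comp_measurable hm
  have h2 : StronglyMeasurable fun p : ℝ × X => g p.2 :=
    (Lp.stronglyMeasurable g).comp_measurable measurable_snd
  have h3 : StronglyMeasurable fun p : ℝ × X => inner ℂ (f (T.toFun (-p.1) p.2)) (g p.2) :=
    h1.inner h2
  exact h3.integral_prod_right'.measurable

theorem norm_inner_koopman_le (T : MeasureFlow X μ) (t : ℝ) (f g : Lp ℂ 2 μ) :
    ‖inner ℂ (T.koopman t f) g‖ ≤ ‖f‖ * ‖g‖ := by
  simpa using norm_inner_le_norm (𝕜 := ℂ) (T.koopman t f) g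

theorem integrable_inner_koopman [SFinite μ] (T : MeasureFlow X μ) (P : Measure ℝ)
    [IsFiniteMeasure P] (f g : Lp ℂ 2 μ) :
    Integrable (fun t : ℝ => inner ℂ (T.koopman (-t) f) g) P :=
  Integrable.of_bound (T.measurable_inner_koopman f g).aestronglyMeasurable (‖f‖ * ‖g‖)
    (ae_of_all _ fun t => T.norm_inner_koopman_le (-t) f g)

/-- The bounded sesquilinear form `(f, g) ↦ ∫ ⟪f ∘ T_{-t}, g⟫ dP(t)` (conjugate linear in `f`, as in
Mathlib's convention for the inner product). -/
noncomputable def integralForm [SFinite μ] (T : MeasureFlow X μ) (P : Measure ℝ)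
    [IsProbabilityMeasure P] : Lp ℂ 2 μ →L⋆[ℂ] Lp ℂ 2 μ →L[ℂ] ℂ :=
  LinearMap.mkContinuous₂
    (LinearMap.mk₂'ₛₗ (starRingEnd ℂ) (RingHom.id ℂ)
      (fun f g => ∫ t, inner ℂ (T.koopman (-t) f) g ∂P)
      (fun f₁ f₂ g => by
        simp only [_root_.map_add, inner_add_left]
        exact integral_add (T.integrable_inner_koopman P f₁ g) (T.integrable_inner_koopman P f₂ g))
      (fun c f g => by
        simp only [map_smul, inner_smul_left]
        exact integral_const_mul _ _)
      (fun f g₁ g₂ => by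
        simp only [inner_add_right]
        exact integral_add (T.integrable_inner_koopman P f g₁) (T.integrable_inner_koopman P f g₂))
      (fun c f g => by
        simp only [inner_smul_right]
        exact integral_const_mul _ _))
    1 (fun f g => by
      rw [one_mul]
      simpa using norm_integral_le_of_norm_le_const (μ := P)
        (ae_of_all _ fun t => T.norm_inner_koopman_le (-t) f g))

/-- The integral operator `P(T)` on `L²(X, μ)`, i.e. `P(T) f = ∫ f ∘ T_{-t} dP(t)` in the weak
sense; see `inner_integralOperator` for its defining property. -/
noncomputable def integralOperator [SFinite μ] (T : MeasureFlow X μ) (P : Measure ℝ)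
    [IsProbabilityMeasure P] : Lp ℂ 2 μ →L[ℂ] Lp ℂ 2 μ :=
  InnerProductSpace.continuousLinearMapOfBilin (T.integralForm P)

theorem inner_integralOperator [SFinite μ] (T : MeasureFlow X μ) (P : Measure ℝ)
    [IsProbabilityMeasure P] (f g : Lp ℂ 2 μ) :
    inner ℂ (T.integralOperator P f) g = ∫ t, inner ℂ (T.koopman (-t) f) g ∂P :=
  InnerProductSpace.continuousLinearMapOfBilin_apply (T.integralForm P) f g

/-- `T_{t_n} → P(T)` weakly: the Koopman operators of `T_{t_n}` converge to `P(T)` in the weak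
operator topology of `L²(X, μ)`. -/
def TendstoWeakly [SFinite μ] (T : MeasureFlow X μ) (t : ℕ → ℝ) (P : Measure ℝ)
    [IsProbabilityMeasure P] : Prop :=
  ∀ f g : Lp ℂ 2 μ, Tendsto (fun n => inner ℂ (T.koopman (t n) f) g) atTop
    (𝓝 (inner ℂ (T.integralOperator P f) g))

/-- The flow is weakly mixing: its only `L²`-eigenfunctions (for any eigenvalue `a ∈ ℝ`,
including `a = 0`) are the constants. -/
def IsWeaklyMixing (T : MeasureFlow X μ) : Prop :=
  ∀ (a : ℝ) (f : Lp ℂ 2 μ),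
    (∀ t : ℝ, T.koopman t f = Complex.exp (Complex.I * (a * t)) • f) →
      ∃ c : ℂ, f =ᵐ[μ] fun _ => c

/-- `σ` is the spectral measure of `f`: the finite Borel measure on `ℝ` with
`∫ e^{its} dσ(s) = ⟨f ∘ T_{-t}, f⟩` for all `t`. (Mathlib's inner product is linear in the second
variable.) -/
def IsSpectralMeasure (T : MeasureFlow X μ) (f : Lp ℂ 2 μ) (σ : Measure ℝ) : Prop :=
  IsFiniteMeasure σ ∧ ∀ t : ℝ, charFun σ t = inner ℂ f (T.koopman (-t) f)

/-- `σ` is a maximal spectral type of the flow, i.e. of its Koopman representation on the space of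
square integrable functions of zero mean: it is the spectral measure of one such function and
dominates the spectral measures of all of them. -/
def IsMaximalSpectralType (T : MeasureFlow X μ) (σ : Measure ℝ) : Prop :=
  (∃ h : Lp ℂ 2 μ, ∫ x, h x ∂μ = 0 ∧ T.IsSpectralMeasure h σ) ∧
    ∀ (f : Lp ℂ 2 μ) (σf : Measure ℝ), ∫ x, f x ∂μ = 0 → T.IsSpectralMeasure f σf → σf ≪ σ

/-- Two flows are spectrally disjoint if their maximal spectral types are mutually singular. (On a
standard Borel probability space maximal spectral types exist, and any two of them are mutually
absolutely continuous.) -/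
def SpectrallyDisjoint {Y : Type*} [MeasurableSpace Y] {ν : Measure Y} (T : MeasureFlow X μ)
    (S : MeasureFlow Y ν) : Prop :=
  ∀ σ τ : Measure ℝ, T.IsMaximalSpectralType σ → S.IsMaximalSpectralType τ →
    Measure.MutuallySingular σ τ

end MeasureFlow

/-- A probability measure on `ℝ` with exponentially decaying tails. -/
def HasExponentialDecay (P : Measure ℝ) : Prop :=
  ∃ c b : ℝ, 0 < c ∧ 0 < b ∧
    ∀ t : ℝ, 0 < t → P.real (Set.Iio (-t) ∪ Set.Ioi t) < c * Real.exp (-b * t)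

/-! Let `σ`, `τ` be the spectral measures of mean zero functions `h`, `k` realising the two maximal
types. Matching `h ∘ T_{-t}` with `e^{its}` turns the weak limit of `T_{t_n}` into `e^{-i t_n s} →
charFun P` weakly in `L²(σ)` (`tendsto_integral_mul`); likewise `e^{-i t_n s} → charFun Q` weakly in
`L²(τ)`. On the common part of `σ` and `τ` the same sequence has both limits. With `ρ = σ + τ`,
densities `p`, `q` and `D = charFun P - charFun Q`, this gives `∫ p q |D|² dρ = 0`.

It remains to see that `D ≠ 0` holds `ρ`-almost everywhere. Exponential decay makes `D` real
analytic, and `P ≠ Q` makes it nonzero, so its zeros are countable (`countable_charFun_eq`). Weak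
mixing excludes atoms of `σ` and `τ` (`IsWeaklyMixing.measure_singleton`): an atom at `a` would
bound the norm from below on the closed convex hull of the `e^{-iat} h ∘ T_{-t}`, whose shortest
vector is a mean zero eigenfunction, hence zero. -/

/-! ### Hilbert space preliminaries -/

/-- Take `v` of minimal norm. Then `U v` has the same norm, and by the parallelogram law the
midpoint of `v` and `U v` would be shorter if they differed. One `v` serves all `U` at once. -/
theorem exists_mem_forall_isometry_fixed {H : Type*} [NormedAddCommGroup H]
    [InnerProductSpace ℂ H] [CompleteSpace H] {K : Set H} (hne : K.Nonempty) (hc : IsClosed K)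
    (hconv : Convex ℝ K) :
    ∃ v ∈ K, ∀ U : H → H, (∀ x, ‖U x‖ = ‖x‖) → Set.MapsTo U K K → U v = v := by
  let := InnerProductSpace.rclikeToReal ℂ H
  obtain ⟨v, hv, hmin⟩ := exists_norm_eq_iInf_of_complete_convex hne hc.isComplete hconv 0
  have hle : ∀ w ∈ K, ‖v‖ ≤ ‖w‖ := by
    intro w hw
    have h := ciInf_le (f := fun w : K => ‖0 - (w : H)‖)
      ⟨0, by rintro _ ⟨x, rfl⟩; positivity⟩ ⟨w, hw⟩
    rw [← hmin] at h
    simpa using h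
  refine ⟨v, hv, fun U hU hUK => ?_⟩
  have hm := hle _ (hconv hv (hUK hv) (a := 1 / 2) (b := 1 / 2) (by norm_num) (by norm_num)
    (by norm_num))
  rw [← smul_add, norm_smul] at hm
  have hp := parallelogram_law_with_norm ℂ v (U v)
  rw [hU] at hp
  norm_num at hm
  have h0 : ‖v - U v‖ = 0 := by
    by_contra hne'
    have : 0 < ‖v - U v‖ := lt_of_le_of_ne (norm_nonneg _) (Ne.symm hne')
    nlinarith [norm_nonneg v, norm_nonneg (v + U v)]
  exact (sub_eq_zero.1 (norm_eq_zero.1 h0)).symm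

theorem tendsto_inner_of_dense_span {H : Type*} [NormedAddCommGroup H] [InnerProductSpace ℂ H]
    {ι : Type*} {l : Filter ι} {e : ι → H} {e₀ : H} {C : ℝ} (hC : ∀ i, ‖e i‖ ≤ C) {s : Set H}
    (hs : Dense (Submodule.span ℂ s : Set H))
    (h : ∀ x ∈ s, Tendsto (fun i => inner ℂ x (e i)) l (𝓝 (inner ℂ x e₀))) (x : H) :
    Tendsto (fun i => inner ℂ x (e i)) l (𝓝 (inner ℂ x e₀)) := by
  have hspan : ∀ y ∈ Submodule.span ℂ s,
      Tendsto (fun i => inner ℂ y (e i)) l (𝓝 (inner ℂ y e₀)) := by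
    intro y hy
    induction hy using Submodule.span_induction with
    | mem y hy => exact h y hy
    | zero => simpa using tendsto_const_nhds
    | add y z _ _ hy hz => simpa only [inner_add_left] using hy.add hz
    | smul c y _ hy => simpa only [inner_smul_left] using hy.const_mul _
  rw [Metric.tendsto_nhds]
  intro ε hε
  -- `M` bounds `‖e i - e₀‖`; the `1` keeps it positive for the division.
  set M := |C| + ‖e₀‖ + 1 with hM
  have hMpos : 0 < M := by positivity
  obtain ⟨y, hy, hxy⟩ := Metric.dense_iff.1 hs x (ε / (2 * M)) (by positivity)
  rw [Metric.mem_ball, dist_eq_norm, norm_sub_rev] at hy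
  have h1 := Metric.tendsto_nhds.1 (hspan y hxy) (ε / 2) (by positivity)
  filter_upwards [h1] with i hi
  rw [dist_eq_norm] at hi ⊢
  have hsplit : inner ℂ x (e i) - inner ℂ x e₀
      = inner ℂ (x - y) (e i - e₀) + (inner ℂ y (e i) - inner ℂ y e₀) := by
    simp only [inner_sub_left, inner_sub_right]; ring
  rw [hsplit]
  have h2 : ‖inner ℂ (x - y) (e i - e₀)‖ ≤ ε / (2 * M) * M := by
    refine (norm_inner_le_norm _ _).trans (mul_le_mul hy.le ?_ (norm_nonneg _) (by positivity))
    have := norm_sub_le (e i) e₀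
    have := hC i
    have := le_abs_self C
    linarith
  have h3 : ε / (2 * M) * M = ε / 2 := by field_simp
  have := norm_add_le (inner ℂ (x - y) (e i - e₀)) (inner ℂ y (e i) - inner ℂ y e₀)
  linarith

/-! ### Characters of the line in `L²(σ)` -/

/-- The character `s ↦ e^{its}` of the real line. -/
noncomputable def realChar (t s : ℝ) : ℂ := Complex.exp (t * s * Complex.I)

theorem continuous_realChar (t : ℝ) : Continuous (realChar t) := by
  unfold realChar; fun_prop

theorem norm_realChar (t s : ℝ) : ‖realChar t s‖ = 1 := by
  rw [realChar, ← Complex.ofReal_mul, Complex.norm_exp_ofReal_mul_I]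

theorem realChar_add (t u s : ℝ) : realChar (t + u) s = realChar t s * realChar u s := by
  simp only [realChar, ← Complex.exp_add]; push_cast; ring_nf

theorem conj_realChar (t s : ℝ) : starRingEnd ℂ (realChar t s) = realChar (-t) s := by
  simp [realChar, ← Complex.exp_conj]

theorem charFun_eq_integral_realChar (σ : Measure ℝ) (t : ℝ) :
    charFun σ t = ∫ s, realChar t s ∂σ := charFun_apply_real t

theorem integrable_realChar (σ : Measure ℝ) [IsFiniteMeasure σ] (t : ℝ) :
    Integrable (realChar t) σ :=
  Integrable.of_bound (continuous_realChar t).aestronglyMeasurable 1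
    (ae_of_all _ fun s => (norm_realChar t s).le)

/-- The positive and negative parts of `g` are densities of two finite measures with equal
characteristic functions, so they agree almost everywhere; having disjoint supports, both vanish. -/
theorem ae_eq_zero_of_integral_mul_realChar_real {σ : Measure ℝ} {g : ℝ → ℝ}
    (hg : Integrable g σ) (h : ∀ t, ∫ s, (g s : ℂ) * realChar t s ∂σ = 0) : g =ᵐ[σ] 0 := by
  have hfin : ∀ {f : ℝ → ℝ}, Integrable f σ →
      IsFiniteMeasure (σ.withDensity fun s => ENNReal.ofReal (f s)) := fun hf =>
    isFiniteMeasure_withDensity_ofReal hf.2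
  have := hfin hg
  have := hfin hg.neg
  have hint : ∀ {f : ℝ → ℝ}, Integrable f σ → ∀ t,
      charFun (σ.withDensity fun s => ENNReal.ofReal (f s)) t
        = ∫ s, ((max (f s) 0 : ℝ) : ℂ) * realChar t s ∂σ := by
    intro f hf t
    rw [charFun_eq_integral_realChar, integral_withDensity_eq_integral_toReal_smul₀
      hf.aemeasurable.ennreal_ofReal (ae_of_all _ fun _ => ENNReal.ofReal_lt_top)]
    simp [ENNReal.toReal_ofReal', Complex.real_smul]
  have hmul : ∀ {f : ℝ → ℝ}, Integrable f σ → ∀ t,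
      Integrable (fun s => ((max (f s) 0 : ℝ) : ℂ) * realChar t s) σ := by
    intro f hf t
    exact hf.pos_part.ofReal.mul_bdd (c := 1) (continuous_realChar t).aestronglyMeasurable
      (ae_of_all _ fun s => (norm_realChar t s).le)
  have heq : σ.withDensity (fun s => ENNReal.ofReal (g s))
      = σ.withDensity fun s => ENNReal.ofReal ((-g) s) := by
    refine Measure.ext_of_charFun (funext fun t => ?_)
    rw [hint hg, hint hg.neg, ← sub_eq_zero, ← integral_sub (hmul hg t) (hmul hg.neg t), ← h t]
    congr 1
    ext s
    rw [← sub_mul, ← Complex.ofReal_sub]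
    congr 2
    rcases le_total (g s) 0 with h0 | h0 <;> simp [h0]
  have hae := (withDensity_eq_iff hg.aemeasurable.ennreal_ofReal
    hg.neg.aemeasurable.ennreal_ofReal (by
      have := measure_ne_top (σ.withDensity fun s => ENNReal.ofReal (g s)) Set.univ
      rwa [withDensity_apply _ MeasurableSet.univ, Measure.restrict_univ] at this)).1 heq
  filter_upwards [hae] with s hs
  rcases le_total (g s) 0 with h0 | h0
  · simp only [Pi.neg_apply, ENNReal.ofReal_of_nonpos h0] at hs
    have := ENNReal.ofReal_eq_zero.1 hs.symm
    simp only [Pi.zero_apply]; linarith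
  · simp only [Pi.neg_apply, ENNReal.ofReal_of_nonpos (neg_nonpos.2 h0)] at hs
    have := ENNReal.ofReal_eq_zero.1 hs
    simp only [Pi.zero_apply]; linarith

theorem ae_eq_zero_of_integral_mul_realChar {σ : Measure ℝ} {g : ℝ → ℂ}
    (hg : Integrable g σ) (h : ∀ t, ∫ s, g s * realChar t s ∂σ = 0) : g =ᵐ[σ] 0 := by
  have hgc : Integrable (fun s => starRingEnd ℂ (g s)) σ := 
    Complex.conjCLE.toContinuousLinearMap.integrable_comp hg
  have hbdd : ∀ {f : ℝ → ℂ}, Integrable f σ → ∀ t,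
      Integrable (fun s => f s * realChar t s) σ := fun hf t =>
    hf.mul_bdd (c := 1) (continuous_realChar t).aestronglyMeasurable
      (ae_of_all _ fun s => (norm_realChar t s).le)
  have h' : ∀ t, ∫ s, starRingEnd ℂ (g s) * realChar t s ∂σ = 0 := by
    intro t
    have := congrArg (starRingEnd ℂ) (h (-t))
    rw [← integral_conj] at this
    simpa [conj_realChar] using this
  have hre : (fun s => (g s).re) =ᵐ[σ] 0 := by
    refine ae_eq_zero_of_integral_mul_realChar_real hg.re fun t => ?_
    have : ∀ s, ((g s).re : ℂ) * realChar t s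
        = (1 / 2) * (g s * realChar t s + starRingEnd ℂ (g s) * realChar t s) := by
      intro s; rw [Complex.re_eq_add_conj]; ring
    simp_rw [this]
    rw [integral_const_mul, integral_add (hbdd hg t) (hbdd hgc t), h, h']; simp
  have him : (fun s => (g s).im) =ᵐ[σ] 0 := by
    refine ae_eq_zero_of_integral_mul_realChar_real hg.im fun t => ?_
    have : ∀ s, ((g s).im : ℂ) * realChar t s
        = (1 / (2 * Complex.I)) * (g s * realChar t s - starRingEnd ℂ (g s) * realChar t s) := by
      intro s; rw [Complex.im_eq_sub_conj]; ring
    simp_rw [this]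
    rw [integral_const_mul, integral_sub (hbdd hg t) (hbdd hgc t), h, h']; simp
  filter_upwards [hre, him] with s h1 h2
  exact Complex.ext h1 h2

theorem memLp_realChar (σ : Measure ℝ) [IsFiniteMeasure σ] (t : ℝ) : MemLp (realChar t) 2 σ :=
  MemLp.of_bound (continuous_realChar t).aestronglyMeasurable 1
    (ae_of_all _ fun s => (norm_realChar t s).le)

theorem inner_toLp_eq_integral {α : Type*} [MeasurableSpace α] {σ : Measure α} {f g : α → ℂ}
    (hf : MemLp f 2 σ) (hg : MemLp g 2 σ) :
    inner ℂ (hf.toLp f) (hg.toLp g) = ∫ s, starRingEnd ℂ (f s) * g s ∂σ := by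
  rw [L2.inner_def]
  refine integral_congr_ae ?_
  filter_upwards [hf.coeFn_toLp, hg.coeFn_toLp] with s h1 h2
  rw [h1, h2, RCLike.inner_apply, mul_comm]

/-- The characters span a dense subspace of `L²(σ)`. -/
theorem dense_span_range_realChar (σ : Measure ℝ) [IsFiniteMeasure σ] :
    Dense (Submodule.span ℂ (Set.range fun t => (memLp_realChar σ t).toLp (realChar t)) :
      Set (Lp ℂ 2 σ)) := by
  rw [Submodule.dense_iff_topologicalClosure_eq_top, Submodule.topologicalClosure_eq_top_iff,
    Submodule.eq_bot_iff]
  intro g hg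
  have hgL := Lp.memLp g
  refine Lp.ext_iff.2 ((ae_eq_zero_of_integral_mul_realChar (hgL.integrable (by norm_num))
    fun t => ?_).trans (Lp.coeFn_zero _ _ _).symm)
  have h0 := (Submodule.mem_orthogonal _ _).1 hg _ (Submodule.subset_span ⟨-t, rfl⟩)
  have h1 := inner_toLp_eq_integral (memLp_realChar σ (-t)) hgL
  rw [Lp.toLp_coeFn, h0] at h1
  simp only [conj_realChar, neg_neg] at h1
  rw [h1]
  simp_rw [mul_comm]

/-- The map `v t ↦ realChar t` preserves inner products, so it is isometric from the span of `v`
into `L²(σ)`. -/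
theorem norm_sq_linearCombination_eq_integral {H : Type*} [NormedAddCommGroup H]
    [InnerProductSpace ℂ H] {σ : Measure ℝ} [IsFiniteMeasure σ] {v : ℝ → H}
    (hv : ∀ t u, inner ℂ (v t) (v u) = charFun σ (u - t)) (c : ℝ →₀ ℂ) :
    ‖Finsupp.linearCombination ℂ v c‖ ^ 2
      = ∫ s, ‖Finsupp.linearCombination ℂ (fun t => realChar t s) c‖ ^ 2 ∂σ := by
  have hC : ((‖Finsupp.linearCombination ℂ v c‖ ^ 2 : ℝ) : ℂ)
      = ((∫ s, ‖Finsupp.linearCombination ℂ (fun t => realChar t s) c‖ ^ 2 ∂σ : ℝ) : ℂ) := by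
    rw [← integral_complex_ofReal]
    have hpt : ∀ s, ((‖Finsupp.linearCombination ℂ (fun t => realChar t s) c‖ ^ 2 : ℝ) : ℂ)
        = ∑ t ∈ c.support, ∑ u ∈ c.support,
          starRingEnd ℂ (c t) * c u * realChar (u - t) s := by
      intro s
      push_cast
      rw [← Complex.conj_mul', Finsupp.linearCombination_apply, Finsupp.sum, map_sum,
        Finset.sum_mul_sum]
      refine Finset.sum_congr rfl fun t _ => Finset.sum_congr rfl fun u _ => ?_
      rw [sub_eq_add_neg, realChar_add, ← conj_realChar]
      simp only [smul_eq_mul, map_mul]; ring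
    simp_rw [hpt]
    rw [integral_finsetSum _ fun t _ => integrable_finsetSum _ fun u _ =>
      (integrable_realChar σ _).const_mul _]
    push_cast
    have := inner_self_eq_norm_sq_to_K (𝕜 := ℂ) (Finsupp.linearCombination ℂ v c)
    simp only [Complex.coe_algebraMap] at this
    rw [← this, Finsupp.linearCombination_apply, Finsupp.sum, sum_inner]
    refine Finset.sum_congr rfl fun t _ => ?_
    rw [inner_sum, integral_finsetSum _ fun u _ => (integrable_realChar σ _).const_mul _]
    refine Finset.sum_congr rfl fun u _ => ?_
    rw [inner_smul_left, inner_smul_right, hv, integral_const_mul, charFun_eq_integral_realChar]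
    ring
  exact_mod_cast hC

/-! ### Exponential decay and analyticity of characteristic functions -/

theorem HasExponentialDecay.exists_integrable_exp_mul_abs {P : Measure ℝ} [IsProbabilityMeasure P]
    (hP : HasExponentialDecay P) : ∃ a > 0, Integrable (fun x : ℝ => Real.exp (a * |x|)) P := by
  obtain ⟨c, b, hc, hb, h⟩ := hP
  refine ⟨b / 2, by positivity, (by fun_prop : Measurable _).aestronglyMeasurable, ?_⟩
  -- The decay bound needs `t > 0`, so `A 0` is the whole line; its mass `1` accounts for the
  -- constant `c + 1` below.
  let A : ℕ → Set ℝ := fun n => if n = 0 then Set.univ else Set.Iio (-(n : ℝ)) ∪ Set.Ioi (n : ℝ)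
  have hA : ∀ n, MeasurableSet (A n) := by
    intro n
    by_cases hn : n = 0
    · simp [A, hn]
    · simp [A, hn]
  have hPA : ∀ n, P.real (A n) ≤ (c + 1) * Real.exp (-b * n) := by
    intro n
    by_cases hn : n = 0
    · simp [A, hn, hc.le]
    · have h1 := h n (by positivity)
      have h2 := Real.exp_pos (-b * n)
      simp only [A, hn, if_false]
      nlinarith
  have hpt : ∀ x : ℝ, ENNReal.ofReal (Real.exp (b / 2 * |x|))
      ≤ ∑' n : ℕ, (A n).indicator (fun _ => ENNReal.ofReal (Real.exp (b / 2 * (n + 1)))) x := by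
    intro x
    -- For `x ≠ 0` this index `n` satisfies `n < |x| ≤ n + 1`, as the open tails require.
    have hx : x ∈ A (⌈|x|⌉₊ - 1) := by
      by_cases hn : ⌈|x|⌉₊ - 1 = 0
      · simp [A, hn]
      · have h1 : ((⌈|x|⌉₊ - 1 : ℕ) : ℝ) < |x| := Nat.lt_ceil.1 (by omega)
        simp only [A, hn, if_false, Set.mem_union, Set.mem_Iio, Set.mem_Ioi]
        rcases lt_abs.1 h1 with h2 | h2
        · exact Or.inr h2
        · left; linarith
    refine le_trans ?_ (ENNReal.le_tsum (⌈|x|⌉₊ - 1))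
    rw [Set.indicator_of_mem hx]
    refine ENNReal.ofReal_le_ofReal (Real.exp_le_exp.2 ?_)
    refine mul_le_mul_of_nonneg_left ((Nat.le_ceil _).trans ?_) (by positivity)
    exact_mod_cast (by omega : ⌈|x|⌉₊ ≤ (⌈|x|⌉₊ - 1) + 1)
  rw [hasFiniteIntegral_iff_ofReal (ae_of_all _ fun x => (Real.exp_pos _).le)]
  refine (lintegral_mono hpt).trans_lt ?_
  rw [lintegral_tsum fun n => (measurable_const.indicator (hA n)).aemeasurable]
  have hterm : ∀ n : ℕ, ∫⁻ x, (A n).indicator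
      (fun _ => ENNReal.ofReal (Real.exp (b / 2 * (n + 1)))) x ∂P
      ≤ ENNReal.ofReal ((c + 1) * Real.exp (b / 2) * Real.exp (-(b / 2)) ^ n) := by
    intro n
    rw [lintegral_indicator_const (hA n), ← ofReal_measureReal,
      ← ENNReal.ofReal_mul (Real.exp_pos _).le]
    refine ENNReal.ofReal_le_ofReal
      ((mul_le_mul_of_nonneg_left (hPA n) (Real.exp_pos _).le).trans (le_of_eq ?_))
    rw [← Real.exp_nat_mul, mul_left_comm, mul_assoc, ← Real.exp_add, ← Real.exp_add]
    congr 2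
    ring
  refine (ENNReal.tsum_le_tsum hterm).trans_lt ?_
  have hs : Summable fun n : ℕ => (c + 1) * Real.exp (b / 2) * Real.exp (-(b / 2)) ^ n :=
    (summable_geometric_of_lt_one (Real.exp_pos _).le
      (by rw [← Real.exp_zero, Real.exp_lt_exp]; linarith)).mul_left _
  rw [← ENNReal.ofReal_tsum_of_nonneg (fun n => by positivity) hs]
  exact ENNReal.ofReal_lt_top

/-- The exponential moment makes the complex moment generating function holomorphic in a strip
around the imaginary axis, where it restricts to `charFun P`. -/
theorem HasExponentialDecay.analyticAt_charFun {P : Measure ℝ} [IsProbabilityMeasure P]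
    (hP : HasExponentialDecay P) (t : ℝ) : AnalyticAt ℝ (charFun P) t := by
  obtain ⟨a, ha, hint⟩ := hP.exists_integrable_exp_mul_abs
  have hsub : Set.Ioo (-a) a ⊆ ProbabilityTheory.integrableExpSet id P := by
    intro r hr
    refine Integrable.mono' hint (by fun_prop) (ae_of_all _ fun x => ?_)
    rw [Real.norm_eq_abs, Real.abs_exp, Real.exp_le_exp]
    calc r * id x ≤ |r * x| := le_abs_self _
      _ = |r| * |x| := abs_mul _ _
      _ ≤ a * |x| := by gcongr; exact (abs_lt.2 hr).le
  have h0 : (0 : ℝ) ∈ interior (ProbabilityTheory.integrableExpSet id P) :=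
    interior_maximal hsub isOpen_Ioo ⟨by linarith, ha⟩
  have h1 : AnalyticAt ℝ (ProbabilityTheory.complexMGF id P) ((t : ℂ) * Complex.I) :=
    (ProbabilityTheory.analyticAt_complexMGF (by simpa using h0)).restrictScalars
  have h2 : AnalyticAt ℝ (fun s : ℝ => (s : ℂ) * Complex.I) t :=
    (Complex.ofRealCLM.analyticAt t).mul analyticAt_const
  have h3 := h1.comp (f := fun s : ℝ => (s : ℂ) * Complex.I) h2
  refine h3.congr (Eventually.of_forall fun s => ?_)
  exact ProbabilityTheory.complexMGF_id_mul_I s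

theorem AnalyticOnNhd.countable_zeros {f : ℝ → ℂ} (hf : AnalyticOnNhd ℝ f Set.univ)
    (hne : f ≠ 0) : {x | f x = 0}.Countable := by
  rcases hf.eqOn_zero_or_eventually_ne_zero_of_preconnected isPreconnected_univ with h | h
  · exact absurd (funext fun x => h (Set.mem_univ x)) hne
  · have h' := mem_codiscrete'.1 h
    have hd : IsDiscrete {x | f x = 0} := by
      convert h'.2 using 1
      ext x; simp
    have := hd.to_subtype
    exact Set.countable_coe_iff.1 (TopologicalSpace.separableSpace_iff_countable.1 inferInstance)

theorem HasExponentialDecay.countable_charFun_eq {P Q : Measure ℝ} [IsProbabilityMeasure P]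
    [IsProbabilityMeasure Q] (hP : HasExponentialDecay P) (hQ : HasExponentialDecay Q)
    (hPQ : P ≠ Q) : {s | charFun P s = charFun Q s}.Countable := by
  have h := AnalyticOnNhd.countable_zeros (f := charFun P - charFun Q)
    (fun s _ => (hP.analyticAt_charFun s).sub (hQ.analyticAt_charFun s))
    (fun h => hPQ (Measure.ext_of_charFun (sub_eq_zero.1 h)))
  simpa [sub_eq_zero] using h

/-! ### Weak mixing and atoms of spectral measures -/

namespace MeasureFlow

variable {X : Type*} [MeasurableSpace X] {μ : Measure X}

theorem koopman_koopman (T : MeasureFlow X μ) (s t : ℝ) (f : Lp ℂ 2 μ) :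
    T.koopman s (T.koopman t f) = T.koopman (t + s) f := by
  refine Lp.ext ?_
  filter_upwards [T.coeFn_koopman s (T.koopman t f), T.coeFn_koopman (t + s) f,
    (T.measurePreserving s).quasiMeasurePreserving.ae (T.coeFn_koopman t f)] with x h1 h2 h3
  rw [h1, h2, h3, T.map_add]

theorem inner_koopman_koopman (T : MeasureFlow X μ) (s t : ℝ) (f g : Lp ℂ 2 μ) :
    inner ℂ (T.koopman s f) (T.koopman t g) = inner ℂ f (T.koopman (t - s) g) := by
  rw [← LinearIsometry.inner_map_map (T.koopman s) f, koopman_koopman, sub_add_cancel]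

theorem IsSpectralMeasure.inner_koopman {T : MeasureFlow X μ} {h : Lp ℂ 2 μ} {σ : Measure ℝ}
    (hσ : T.IsSpectralMeasure h σ) (t u : ℝ) :
    inner ℂ (T.koopman (-t) h) (T.koopman (-u) h) = charFun σ (u - t) := by
  rw [hσ.2, inner_koopman_koopman]; ring_nf

/-- The closed convex hull of `{e^{-iat} h ∘ T_{-t}}`, in which an eigenfunction is sought. -/
noncomputable def twistedHull (T : MeasureFlow X μ) (a : ℝ) (h : Lp ℂ 2 μ) : Set (Lp ℂ 2 μ) :=
  closure (convexHull ℝ (Set.range fun t => realChar (-t) a • T.koopman (-t) h))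

/-- A point of the convex hull corresponds to a trigonometric polynomial equal to `1` at `a`. Its
squared norm is the integral of the squared modulus, at least the mass of `a`; the bound survives
closure. -/
theorem measureReal_singleton_le_norm_sq {T : MeasureFlow X μ} {h : Lp ℂ 2 μ} {σ : Measure ℝ}
    (hσ : T.IsSpectralMeasure h σ) {a : ℝ} {v : Lp ℂ 2 μ} (hv : v ∈ T.twistedHull a h) :
    σ.real {a} ≤ ‖v‖ ^ 2 := by
  have := hσ.1
  let Φ := Finsupp.linearCombination ℂ fun t => T.koopman (-t) h
  let ψ := Finsupp.linearCombination ℂ fun t => realChar t a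
  have hconv : Convex ℝ ((Φ.restrictScalars ℝ) '' ((ψ.restrictScalars ℝ) ⁻¹' {1})) :=
    ((convex_singleton (1 : ℂ)).linear_preimage _).linear_image _
  have hsub : convexHull ℝ (Set.range fun t => realChar (-t) a • T.koopman (-t) h)
      ⊆ (Φ.restrictScalars ℝ) '' ((ψ.restrictScalars ℝ) ⁻¹' {1}) := by
    refine convexHull_min ?_ hconv
    rintro _ ⟨t, rfl⟩
    refine ⟨Finsupp.single t (realChar (-t) a), ?_, by simp [Φ]⟩
    simp [ψ, realChar, ← Complex.exp_add]
  have hclosed : IsClosed {w : Lp ℂ 2 μ | σ.real {a} ≤ ‖w‖ ^ 2} :=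
    isClosed_le continuous_const (by fun_prop)
  refine closure_minimal (hsub.trans ?_) hclosed hv
  rintro _ ⟨c, hc, rfl⟩
  have hc' : ψ c = 1 := hc
  change σ.real {a} ≤ ‖Φ c‖ ^ 2
  rw [norm_sq_linearCombination_eq_integral hσ.inner_koopman c]
  have hcont : Continuous fun s => Finsupp.linearCombination ℂ (fun t => realChar t s) c := by
    simp only [Finsupp.linearCombination_apply, Finsupp.sum]
    exact continuous_finsetSum _ fun t _ => continuous_const.mul (continuous_realChar t)
  have hint : Integrable
      (fun s => ‖Finsupp.linearCombination ℂ (fun t => realChar t s) c‖ ^ 2) σ := by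
    refine Integrable.of_bound (hcont.norm.pow 2).aestronglyMeasurable
      ((∑ t ∈ c.support, ‖c t‖) ^ 2) (ae_of_all _ fun s => ?_)
    rw [norm_pow, norm_norm]
    gcongr
    rw [Finsupp.linearCombination_apply, Finsupp.sum]
    refine (norm_sum_le _ _).trans (le_of_eq ?_)
    simp [norm_realChar]
  calc σ.real {a} = ∫ s in {a}, ‖Finsupp.linearCombination ℂ (fun t => realChar t s) c‖ ^ 2 ∂σ := by
        rw [integral_singleton]
        change _ = _ • ‖ψ c‖ ^ 2
        simp [hc']
    _ ≤ _ := setIntegral_le_integral hint (ae_of_all _ fun s => by positivity)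

theorem mapsTo_twistedHull (T : MeasureFlow X μ) (a : ℝ) (h : Lp ℂ 2 μ) (u : ℝ) :
    Set.MapsTo (fun f => realChar (-u) a • T.koopman (-u) f) (T.twistedHull a h)
      (T.twistedHull a h) := by
  let U : Lp ℂ 2 μ →L[ℝ] Lp ℂ 2 μ :=
    (realChar (-u) a • (T.koopman (-u)).toContinuousLinearMap).restrictScalars ℝ
  have hU : Set.MapsTo U (convexHull ℝ (Set.range fun t => realChar (-t) a • T.koopman (-t) h))
      (convexHull ℝ (Set.range fun t => realChar (-t) a • T.koopman (-t) h)) := by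
    rw [Set.mapsTo_iff_image_subset, ← ContinuousLinearMap.coe_coe, LinearMap.image_convexHull]
    refine convexHull_mono ?_
    rintro _ ⟨_, ⟨t, rfl⟩, rfl⟩
    refine ⟨t + u, ?_⟩
    change _ = realChar (-u) a • T.koopman (-u) (realChar (-t) a • T.koopman (-t) h)
    rw [map_smul, koopman_koopman, smul_smul, ← realChar_add]
    simp only [neg_add_rev]
    rw [add_comm (-t) (-u)]
  exact hU.closure U.continuous

theorem integral_eq_zero_of_mem_twistedHull [IsProbabilityMeasure μ] {T : MeasureFlow X μ} {a : ℝ}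
    {h v : Lp ℂ 2 μ} (hh : ∫ x, h x ∂μ = 0) (hv : v ∈ T.twistedHull a h) : ∫ x, v x ∂μ = 0 := by
  have hone : ∀ f : Lp ℂ 2 μ,
      inner ℂ ((memLp_const (1 : ℂ)).toLp (fun _ : X => (1 : ℂ))) f = ∫ x, f x ∂μ := by
    intro f
    have := inner_toLp_eq_integral (memLp_const (μ := μ) (p := 2) (1 : ℂ)) (Lp.memLp f)
    rw [Lp.toLp_coeFn] at this
    simpa using this
  let L := (innerSL ℂ ((memLp_const (1 : ℂ)).toLp (fun _ : X => (1 : ℂ)) : Lp ℂ 2 μ))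
  have hL : ∀ f, L f = ∫ x, f x ∂μ := hone
  have hker : v ∈ (L.restrictScalars ℝ) ⁻¹' {0} := by
    refine closure_minimal (convexHull_min ?_ ?_)
      (isClosed_singleton.preimage (L.restrictScalars ℝ).continuous) hv
    · rintro _ ⟨t, rfl⟩
      change L (realChar (-t) a • T.koopman (-t) h) = 0
      rw [map_smul, hL, integral_congr_ae (T.coeFn_koopman (-t) h),
        ← integral_map (T.measurePreserving (-t)).aemeasurable
          (by rw [(T.measurePreserving (-t)).map_eq]; exact (Lp.memLp h).1),
        (T.measurePreserving (-t)).map_eq, hh, smul_zero]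
    · exact (convex_singleton (0 : ℂ)).linear_preimage (L.restrictScalars ℝ).toLinearMap
  rw [← hL]; exact hker

/-- Spectral measures of mean zero functions of a weakly mixing flow have no atoms. -/
theorem IsWeaklyMixing.measure_singleton [IsProbabilityMeasure μ] {T : MeasureFlow X μ}
    (hT : T.IsWeaklyMixing) {h : Lp ℂ 2 μ} (hh : ∫ x, h x ∂μ = 0) {σ : Measure ℝ}
    (hσ : T.IsSpectralMeasure h σ) (a : ℝ) : σ {a} = 0 := by
  have := hσ.1
  obtain ⟨v, hv, hfix⟩ := exists_mem_forall_isometry_fixed (K := T.twistedHull a h)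
    ((Set.range_nonempty _).convexHull.closure) isClosed_closure (convex_convexHull ℝ _).closure
  have heig : ∀ u, realChar (-u) a • T.koopman (-u) v = v := fun u =>
    hfix _ (fun x => by rw [norm_smul, norm_realChar, one_mul, LinearIsometry.norm_map])
      (T.mapsTo_twistedHull a h u)
  -- Fixedness at time `-t` reads `T_t v = e^{-iat} v`, hence the eigenvalue parameter `-a`.
  obtain ⟨c, hc⟩ := hT (-a) v fun t => by
    have h1 := congrArg (fun w => realChar (-t) a • w) (heig (-t))
    simp only [neg_neg, smul_smul, ← realChar_add, neg_add_cancel] at h1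
    have h0 : realChar 0 a = 1 := by simp [realChar]
    rw [h0, one_smul] at h1
    rw [h1, realChar]
    congr 2
    push_cast; ring
  have hc0 : c = 0 := by
    have := integral_eq_zero_of_mem_twistedHull hh hv
    rw [integral_congr_ae hc] at this
    simpa using this
  have hv0 : v = 0 := by
    refine Lp.ext (hc.trans ?_)
    filter_upwards [Lp.coeFn_zero ℂ 2 μ] with x hx
    rw [hx, hc0]; rfl
  have hle := measureReal_singleton_le_norm_sq hσ hv
  rw [hv0] at hle
  have : σ.real {a} = 0 := le_antisymm (by simpa using hle) measureReal_nonneg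
  exact (measureReal_eq_zero_iff).1 this

/-! ### Weak limits of characters in `L²(σ)` -/

theorem integral_charFun_add (P σ : Measure ℝ) [IsFiniteMeasure P] [IsFiniteMeasure σ] (u : ℝ) :
    ∫ t, charFun σ (t + u) ∂P = ∫ s, realChar u s * charFun P s ∂σ := by
  simp_rw [charFun_eq_integral_realChar]
  rw [integral_integral_swap]
  · refine integral_congr_ae (ae_of_all _ fun s => ?_)
    simp only [realChar_add]
    rw [integral_mul_const, mul_comm]
    congr 1
    refine integral_congr_ae (ae_of_all _ fun t => ?_)
    simp only [realChar]; ring_nf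
  · refine Integrable.of_bound (Continuous.aestronglyMeasurable ?_) 1
      (ae_of_all _ fun p => (norm_realChar _ _).le)
    unfold Function.uncurry realChar
    fun_prop

theorem IsSpectralMeasure.tendsto_integral_realChar [SFinite μ] {T : MeasureFlow X μ}
    {h : Lp ℂ 2 μ} {σ : Measure ℝ} (hσ : T.IsSpectralMeasure h σ) {t : ℕ → ℝ} {P : Measure ℝ}
    [IsProbabilityMeasure P] (hTP : T.TendstoWeakly t P) (u : ℝ) :
    Tendsto (fun n => ∫ s, realChar u s * realChar (-t n) s ∂σ) atTop
      (𝓝 (∫ s, realChar u s * charFun P s ∂σ)) := by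
  have := hσ.1
  -- Conjugation turns the inner products of `T_r h` with `T_u h` into `charFun σ (u - r)`.
  have h1 := (Complex.continuous_conj.tendsto _).comp (hTP h (T.koopman u h))
  have h2 : ∀ r, starRingEnd ℂ (inner ℂ (T.koopman r h) (T.koopman u h))
      = charFun σ (u - r) := by
    intro r
    rw [inner_conj_symm, inner_koopman_koopman, hσ.2]; ring_nf
  rw [inner_integralOperator, ← integral_conj] at h1
  simp only [h2, Function.comp_def, sub_neg_eq_add] at h1
  simp_rw [add_comm u] at h1
  rw [integral_charFun_add P σ u] at h1
  refine h1.congr fun n => ?_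
  rw [charFun_eq_integral_realChar]
  simp_rw [sub_eq_add_neg, realChar_add]

theorem memLp_charFun (P σ : Measure ℝ) [IsProbabilityMeasure P] [IsFiniteMeasure σ] :
    MemLp (charFun P) 2 σ :=
  MemLp.of_bound measurable_charFun.aestronglyMeasurable 1
    (ae_of_all _ fun s => norm_charFun_le_one s)

theorem IsSpectralMeasure.tendsto_integral_mul [SFinite μ] {T : MeasureFlow X μ}
    {h : Lp ℂ 2 μ} {σ : Measure ℝ} (hσ : T.IsSpectralMeasure h σ) {t : ℕ → ℝ} {P : Measure ℝ}
    [IsProbabilityMeasure P] (hTP : T.TendstoWeakly t P) {g : ℝ → ℂ} (hg : MemLp g 2 σ) :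
    Tendsto (fun n => ∫ s, g s * realChar (-t n) s ∂σ) atTop
      (𝓝 (∫ s, g s * charFun P s ∂σ)) := by
  have := hσ.1
  have key := tendsto_inner_of_dense_span (l := atTop)
    (e := fun n => (memLp_realChar σ (-t n)).toLp _) (e₀ := (memLp_charFun P σ).toLp _)
    -- `C` is the `L²(σ)` norm of any unimodular function. The test vector is `g.star` because the
    -- inner product conjugates its first slot.
    (C := σ.real Set.univ ^ (1 / 2 : ℝ)) (fun n => ?_) (dense_span_range_realChar σ) ?_
    (hg.star.toLp _)
  · simp only [inner_toLp_eq_integral] at key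
    simpa using key
  · have := Lp.norm_le_of_ae_bound (f := (memLp_realChar σ (-t n)).toLp _) (C := 1) zero_le_one (by
      filter_upwards [(memLp_realChar σ (-t n)).coeFn_toLp] with s hs
      rw [hs, norm_realChar])
    simpa [measureUnivNNReal, Measure.real, ENNReal.coe_toNNReal_eq_toReal] using this
  · rintro _ ⟨u, rfl⟩
    simp only [inner_toLp_eq_integral, conj_realChar]
    exact hσ.tendsto_integral_realChar hTP (-u)

end MeasureFlow

/-! ### Mutual singularity -/

theorem mutuallySingular_of_rnDeriv_mul_eq_zero {α : Type*} [MeasurableSpace α]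
    {σ τ ρ : Measure α} [SigmaFinite σ] [SigmaFinite τ] [SigmaFinite ρ] (hσ : σ ≪ ρ) (hτ : τ ≪ ρ)
    (h : ∀ᵐ x ∂ρ, σ.rnDeriv ρ x = 0 ∨ τ.rnDeriv ρ x = 0) : Measure.MutuallySingular σ τ := by
  have hm : MeasurableSet {x | σ.rnDeriv ρ x = 0} :=
    Measure.measurable_rnDeriv σ ρ (measurableSet_singleton 0)
  refine ⟨{x | σ.rnDeriv ρ x = 0}, hm, ?_, ?_⟩
  · rw [← Measure.setLIntegral_rnDeriv hσ, setLIntegral_congr_fun hm fun x hx => hx]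
    simp
  · rw [← Measure.setLIntegral_rnDeriv hτ,
      setLIntegral_eq_zero_iff hm.compl (Measure.measurable_rnDeriv τ ρ)]
    filter_upwards [h] with x hx hxs
    exact hx.resolve_left hxs

theorem theorem3p2 {X Y : Type*} [MeasurableSpace X] [StandardBorelSpace X]
    [MeasurableSpace Y] [StandardBorelSpace Y]
    (μ : Measure X) [IsProbabilityMeasure μ] (ν : Measure Y) [IsProbabilityMeasure ν]
    (T : MeasureFlow X μ) (S : MeasureFlow Y ν)
    (hT : T.IsWeaklyMixing) (hS : S.IsWeaklyMixing)
    (P Q : Measure ℝ) [IsProbabilityMeasure P] [IsProbabilityMeasure Q]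
    (hP : HasExponentialDecay P) (hQ : HasExponentialDecay Q)
    (t : ℕ → ℝ) (ht : Tendsto t atTop atTop)
    (hTP : T.TendstoWeakly t P) (hSQ : S.TendstoWeakly t Q)
    (hPQ : P ≠ Q) :
    T.SpectrallyDisjoint S := by
  rintro σ τ ⟨⟨h, hh, hσ⟩, -⟩ ⟨⟨k, hk, hτ⟩, -⟩
  have := hσ.1
  have := hτ.1
  have hσρ : σ ≪ σ + τ := Measure.le_add_right le_rfl |>.absolutelyContinuous
  have hτρ : τ ≪ σ + τ := Measure.le_add_left le_rfl |>.absolutelyContinuous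
  set ρ := σ + τ with hρ
  set p : ℝ → ℝ := fun s => (σ.rnDeriv ρ s).toReal with hp
  set q : ℝ → ℝ := fun s => (τ.rnDeriv ρ s).toReal with hq
  have hpm : Measurable p := (Measure.measurable_rnDeriv σ ρ).ennreal_toReal
  have hqm : Measurable q := (Measure.measurable_rnDeriv τ ρ).ennreal_toReal
  have hp1 : ∀ᵐ s ∂ρ, ‖(p s : ℂ)‖ ≤ 1 := by
    filter_upwards [Measure.rnDeriv_le_one_of_le (Measure.le_add_right le_rfl : σ ≤ ρ)] with s hs
    rw [Complex.norm_real, Real.norm_of_nonneg ENNReal.toReal_nonneg]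
    exact ENNReal.toReal_le_of_le_ofReal zero_le_one (by simpa using hs)
  have hq1 : ∀ᵐ s ∂ρ, ‖(q s : ℂ)‖ ≤ 1 := by
    filter_upwards [Measure.rnDeriv_le_one_of_le (Measure.le_add_left le_rfl : τ ≤ ρ)] with s hs
    rw [Complex.norm_real, Real.norm_of_nonneg ENNReal.toReal_nonneg]
    exact ENNReal.toReal_le_of_le_ofReal zero_le_one (by simpa using hs)
  set D : ℝ → ℂ := fun s => charFun P s - charFun Q s with hD
  have hDm : Measurable D := measurable_charFun.sub measurable_charFun
  have hD2 : ∀ s, ‖D s‖ ≤ 2 := fun s =>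
    (norm_sub_le _ _).trans
      ((add_le_add (norm_charFun_le_one s) (norm_charFun_le_one s)).trans (by norm_num))
  have hDc : Measurable fun s => starRingEnd ℂ (D s) := Complex.continuous_conj.measurable.comp hDm
  have hmem : ∀ {r : ℝ → ℝ} {κ : Measure ℝ} [IsFiniteMeasure κ], Measurable r → κ ≪ ρ →
      (∀ᵐ s ∂ρ, ‖(r s : ℂ)‖ ≤ 1) → MemLp (fun s => (r s : ℂ) * starRingEnd ℂ (D s)) 2 κ := by
    intro r κ _ hr hκ hr1
    refine MemLp.of_bound ((Complex.measurable_ofReal.comp hr).mul hDc).aestronglyMeasurable 2 ?_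
    filter_upwards [hκ hr1] with s hs
    rw [norm_mul, RCLike.norm_conj]
    nlinarith [hD2 s, norm_nonneg (D s), norm_nonneg (r s : ℂ)]
  -- Testing with `q * conj D` against `σ` and `p * conj D` against `τ` produces the same integrals
  -- against `ρ`, so the two limits coincide.
  have h1 := hσ.tendsto_integral_mul hTP (hmem hqm hσρ hq1)
  have h2 := hτ.tendsto_integral_mul hSQ (hmem hpm hτρ hp1)
  have e1 : ∀ F : ℝ → ℂ, ∫ s, (q s : ℂ) * starRingEnd ℂ (D s) * F s ∂σ
      = ∫ s, (p s : ℂ) * q s * starRingEnd ℂ (D s) * F s ∂ρ := by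
    intro F
    rw [← integral_rnDeriv_smul hσρ]
    simp only [Complex.real_smul, mul_assoc, hp]
  have e2 : ∀ F : ℝ → ℂ, ∫ s, (p s : ℂ) * starRingEnd ℂ (D s) * F s ∂τ
      = ∫ s, (p s : ℂ) * q s * starRingEnd ℂ (D s) * F s ∂ρ := by
    intro F
    rw [← integral_rnDeriv_smul hτρ]
    refine integral_congr_ae (ae_of_all _ fun s => ?_)
    simp only [Complex.real_smul, hq]; ring
  simp only [e1] at h1
  simp only [e2] at h2
  have hlim := tendsto_nhds_unique h1 h2
  have hint : ∀ R : Measure ℝ, [IsProbabilityMeasure R] →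
      Integrable (fun s => (p s : ℂ) * q s * starRingEnd ℂ (D s) * charFun R s) ρ := by
    intro R _
    refine Integrable.of_bound (C := 2) (by fun_prop) ?_
    filter_upwards [hp1, hq1] with s h3 h4
    rw [norm_mul, norm_mul, norm_mul, RCLike.norm_conj]
    calc _ ≤ (1 : ℝ) * 1 * 2 * 1 := by
          gcongr
          · exact hD2 s
          · exact norm_charFun_le_one s
      _ = 2 := by norm_num
  rw [← sub_eq_zero, ← integral_sub (hint P) (hint Q)] at hlim
  have hsq : ∀ s, (p s : ℂ) * q s * starRingEnd ℂ (D s) * charFun P s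
      - (p s : ℂ) * q s * starRingEnd ℂ (D s) * charFun Q s
      = ((p s * q s * ‖D s‖ ^ 2 : ℝ) : ℂ) := by
    intro s
    rw [← mul_sub]
    push_cast
    rw [← Complex.conj_mul']
    ring
  have hreal := (hint P).sub (hint Q)
  simp only [Pi.sub_def, hsq] at hlim hreal
  rw [integral_complex_ofReal, Complex.ofReal_eq_zero, integral_eq_zero_iff_of_nonneg
    (fun s => mul_nonneg (mul_nonneg ENNReal.toReal_nonneg ENNReal.toReal_nonneg) (by positivity))
    (by simpa only [RCLike.re_to_complex, Complex.ofReal_re] using hreal.re)] at hlim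
  have hcount := hP.countable_charFun_eq hQ hPQ
  -- Weak mixing enters here: atomless measures do not charge the countable zero set of `D`.
  have hnull : ρ {s | charFun P s = charFun Q s} = 0 := by
    rw [hρ, Measure.add_apply]
    have : NullSingletonClass σ := ⟨hT.measure_singleton hh hσ⟩
    have : NullSingletonClass τ := ⟨hS.measure_singleton hk hτ⟩
    rw [hcount.measure_zero, hcount.measure_zero, add_zero]
  refine mutuallySingular_of_rnDeriv_mul_eq_zero hσρ hτρ ?_
  filter_upwards [hlim, measure_eq_zero_iff_ae_notMem.1 hnull, Measure.rnDeriv_lt_top σ ρ,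
    Measure.rnDeriv_lt_top τ ρ] with s hs hne hσt hτt
  have hDs : ‖D s‖ ^ 2 ≠ 0 := by
    simpa [hD, sub_eq_zero] using hne
  rcases mul_eq_zero.1 ((mul_eq_zero.1 hs).resolve_right hDs) with h0 | h0
  · exact Or.inl ((ENNReal.toReal_eq_zero_iff _).1 h0 |>.resolve_right hσt.ne)
  · exact Or.inr ((ENNReal.toReal_eq_zero_iff _).1 h0 |>.resolve_right hτt.ne)
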